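/- A quantum Turing machine (QTM) $M$ has finitely many states (with an initial state $q_0$ and a final state $q_f\neq q_0$) and several two-way infinite tracks with cells indexed by $\mathbb{Z}$ and one common head. All tracks but the last use a finite alphabet containing $0$, $1$ and a blank $\#$; the last (output) track uses $\{0,1,\#\}$. In state $p$, scanning the tuple of track symbols $\sigma$, the machine enters state $q$, writes $\tau$ and moves one cell in direction $d\in\{L,R\}$ with amplitude $\delta(p,\sigma,q,\tau,d)\in\mathbb{C}$. This defines a linear time-evolution operator on the finite complex linear combinations of configurations (configurations have finitely many nonblank cells). The input $x\in\{0,1\}^*$ is written on the first track from cell $0$ (the start cell) on, everything else is blank, the head is in the start cell, and the state is $q_0$. $M$ on input $x$ halts in time $T$ if at time $T$ all configurations in the superposition have state $q_f$, and at no earlier time does the superposition contain a configuration with state $q_f$. $M$ is polynomial-time if there is a polynomial $p$ with integer coefficients such that $M$ halts in time $p(|x|)$ on every input $x$. $M$ is conservative if its time-evolution operator preserves the $L_2$-norm, on every input it halts in a superposition all of whose configurations have the head in the start cell, and $\delta(q_f,\sigma)=|q_0\rangle|\sigma\rangle|R\rangle$ for every $\sigma$. $M$ accepts $x$ with probability $r$,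 and rejects $x$ with probability $1-r$, if $M$ halts on $x$ and, in the superposition at that time, the squared magnitudes of the amplitudes of those configurations with state $q_f$ whose output track holds $1$ in the start cell and is blank elsewhere sum to $r$. Let $\mathrm{BQP}_{\mathbb{C}}$ be the class of all $S\subseteq\{0,1\}^*$ for which there is a polynomial-time conservative QTM with complex amplitudes that accepts every $x\in S$ with probability at least $2/3$ and rejects every $x\notin S$ with probability at least $2/3$. Let $\mathrm{NQP}_{\mathbb{C}}$ be the class of all $S\subseteq\{0,1\}^*$ for which there is a polynomial-time conservative QTM with complex amplitudes that accepts every $x\in S$ with positive probability and rejects every $x\notin S$ with probability $1$. Corollary. $\mathrm{BQP}_{\mathbb{C}}\neq\mathrm{NQP}_{\mathbb{C}}$. -/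

import Mathlib

/-- The displacement of the head for the directions `L` and `R`. -/
def Turing.Dir.shift : Turing.Dir → ℤ
  | Turing.Dir.left => -1
  | Turing.Dir.right => 1

/-- A multitrack quantum Turing machine with complex amplitudes. There are `tracks + 1` tracks over
the finite alphabet `Alphabet` (the first of them holds the input), followed by the output track,
whose alphabet is `{0, 1, #}`, here `Option Bool` with `none` as blank. The binary input symbols
`0, 1` are two different nonblank letters of `Alphabet`. -/
structure QTM where
  tracks : ℕ
  Alphabet : Type
  [fintypeAlphabet : Fintype Alphabet]
  blank : Alphabet
  bit : Bool → Alphabet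
  bit_injective : Function.Injective bit
  bit_ne_blank : ∀ b, bit b ≠ blank
  State : Type
  [fintypeState : Fintype State]
  start : State
  final : State
  start_ne_final : start ≠ final
  /-- `amp p σ q τ d` is the amplitude of `|q⟩|τ⟩|d⟩` in `δ(p, σ)`. -/
  amp : State → (Fin (tracks + 1) → Alphabet) × Option Bool →
    State → (Fin (tracks + 1) → Alphabet) × Option Bool → Turing.Dir → ℂ

namespace QTM

attribute [instance] QTM.fintypeAlphabet QTM.fintypeState

/-- The content of one cell: a letter on each of the tracks. -/
abbrev Symbol (M : QTM) : Type := (Fin (M.tracks + 1) → M.Alphabet) × Option Bool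

/-- The content of a cell that is blank on every track. -/
def blankSymbol (M : QTM) : M.Symbol := (fun _ => M.blank, none)

/-- A configuration: state, head position, and two-way infinite tape content with only finitely
many nonblank cells. -/
@[ext]
structure Config (M : QTM) where
  state : M.State
  head : ℤ
  tape : ℤ → M.Symbol
  finite_nonblank : {i | tape i ≠ M.blankSymbol}.Finite

/-- The configuration obtained from `c` by writing `τ` in the scanned cell, entering the state `q`
and moving the head one cell in the direction `d`. -/
def Config.next {M : QTM} (c : M.Config) (q : M.State) (τ : M.Symbol) (d : Turing.Dir) :
    M.Config where
  state := q
  head := c.head + d.shift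
  tape := Function.update c.tape c.head τ
  finite_nonblank := by
    refine (c.finite_nonblank.insert c.head).subset fun i hi => ?_
    by_cases h : i = c.head
    · exact Or.inl h
    · right
      simpa [Function.update_of_ne h] using hi

/-- The tape content for the input `x`: the letters of `x` stand on the first track in the cells
`0, 1, …, |x| - 1`, and everything else is blank. -/
def inputTape (M : QTM) (x : List Bool) (i : ℤ) : M.Symbol :=
  if h : 0 ≤ i ∧ i.toNat < x.length then
    (fun j => if j = 0 then M.bit (x[i.toNat]'h.2) else M.blank, none)
  else M.blankSymbol

/-- The initial configuration on input `x`; the start cell is the cell `0`. -/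
def initial (M : QTM) (x : List Bool) : M.Config where
  state := M.start
  head := 0
  tape := M.inputTape x
  finite_nonblank := by
    refine (Set.finite_Icc (0 : ℤ) x.length).subset fun i hi => ?_
    by_cases h : 0 ≤ i ∧ i.toNat < x.length
    · exact ⟨h.1, by omega⟩
    · exact absurd (by simp [inputTape, h]) hi

/-- The result of a single application of the transition function to the configuration `c`. -/
noncomputable def step (M : QTM) (c : M.Config) : M.Config →₀ ℂ :=
  ∑ q : M.State, ∑ τ : M.Symbol,
    (Finsupp.single (c.next q τ Turing.Dir.left)
        (M.amp c.state (c.tape c.head) q τ Turing.Dir.left) +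
      Finsupp.single (c.next q τ Turing.Dir.right)
        (M.amp c.state (c.tape c.head) q τ Turing.Dir.right))

/-- The time-evolution operator, on finite complex linear combinations of configurations. -/
noncomputable def evolution (M : QTM) : (M.Config →₀ ℂ) →ₗ[ℂ] (M.Config →₀ ℂ) :=
  Finsupp.linearCombination ℂ M.step

/-- The square of the `L₂`-norm of a finite linear combination of configurations. -/
noncomputable def sqNorm {M : QTM} (ψ : M.Config →₀ ℂ) : ℝ :=
  ψ.sum fun _ z => ‖z‖ ^ 2

/-- The superposition of `M` on input `x` at time `t`. -/
noncomputable def superposition (M : QTM) (x : List Bool) (t : ℕ) : M.Config →₀ ℂ :=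
  M.evolution^[t] (Finsupp.single (M.initial x) 1)

/-- `M` on input `x` halts in time `T`: at time `T` there are only final configurations, and before
time `T` there are none. -/
def HaltsIn (M : QTM) (x : List Bool) (T : ℕ) : Prop :=
  (∀ c ∈ (M.superposition x T).support, c.state = M.final) ∧
    ∀ t < T, ∀ c ∈ (M.superposition x t).support, c.state ≠ M.final

/-- There is an integer polynomial `p` such that `M` halts in time `p(|x|)` on every input `x`. -/
def PolynomialTime (M : QTM) : Prop :=
  ∃ p : Polynomial ℤ, ∀ x : List Bool, ∃ T : ℕ, (T : ℤ) = p.eval (x.length : ℤ) ∧ M.HaltsIn x T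

/-- The time-evolution operator preserves the `L₂`-norm. -/
def WellFormed (M : QTM) : Prop :=
  ∀ ψ : M.Config →₀ ℂ, sqNorm (M.evolution ψ) = sqNorm ψ

/-- On every input the machine halts, in a final superposition all of whose configurations have the
head in the start cell. -/
def Stationary (M : QTM) : Prop :=
  ∀ x : List Bool, ∃ T : ℕ, M.HaltsIn x T ∧ ∀ c ∈ (M.superposition x T).support, c.head = 0

open Classical in
/-- `δ(q_f, σ) = |q₀⟩|σ⟩|R⟩` for every `σ`. -/
def NormalForm (M : QTM) : Prop :=
  ∀ (σ : M.Symbol) (q : M.State) (τ : M.Symbol) (d : Turing.Dir),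
    M.amp M.final σ q τ d = if q = M.start ∧ τ = σ ∧ d = Turing.Dir.right then 1 else 0

/-- Well-formed, stationary and in normal form. -/
def Conservative (M : QTM) : Prop :=
  M.WellFormed ∧ M.Stationary ∧ M.NormalForm

/-- All transition amplitudes are drawn from `K`. -/
def HasAmplitudesIn (M : QTM) (K : Set ℂ) : Prop :=
  ∀ (p : M.State) (σ : M.Symbol) (q : M.State) (τ : M.Symbol) (d : Turing.Dir), M.amp p σ q τ d ∈ K

/-- A final configuration whose output track holds `1` in the start cell and is blank elsewhere. -/
def Config.IsAccepting {M : QTM} (c : M.Config) : Prop :=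
  c.state = M.final ∧ (c.tape 0).2 = some true ∧ ∀ i : ℤ, i ≠ 0 → (c.tape i).2 = none

open Classical in
/-- The sum of the squared magnitudes of the amplitudes of the accepting configurations in `ψ`. -/
noncomputable def acceptingWeight {M : QTM} (ψ : M.Config →₀ ℂ) : ℝ :=
  ∑ c ∈ ψ.support with c.IsAccepting, ‖ψ c‖ ^ 2

/-- `M` halts on `x`, and accepts it with probability `r`. -/
def AcceptsWithProb (M : QTM) (x : List Bool) (r : ℝ) : Prop :=
  ∃ T : ℕ, M.HaltsIn x T ∧ acceptingWeight (M.superposition x T) = r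

/-- `M` rejects `x` with probability `r`, that is, accepts it with probability `1 - r`. -/
def RejectsWithProb (M : QTM) (x : List Bool) (r : ℝ) : Prop :=
  M.AcceptsWithProb x (1 - r)

end QTM

/-- `NQP_K`, as a class of sets of binary strings. -/
def NQP (K : Set ℂ) : Set (Set (List Bool)) :=
  {S | ∃ M : QTM, M.PolynomialTime ∧ M.Conservative ∧ M.HasAmplitudesIn K ∧ ∀ x : List Bool,
    (x ∈ S → ∃ r : ℝ, 0 < r ∧ M.AcceptsWithProb x r) ∧ (x ∉ S → M.RejectsWithProb x 1)}

/-- `BQP_K`, as a class of sets of binary strings. -/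
def BQP (K : Set ℂ) : Set (Set (List Bool)) :=
  {S | ∃ M : QTM, M.PolynomialTime ∧ M.Conservative ∧ M.HasAmplitudesIn K ∧ ∀ x : List Bool,
    (x ∈ S → ∃ r : ℝ, 2 / 3 ≤ r ∧ M.AcceptsWithProb x r) ∧
      (x ∉ S → ∃ r : ℝ, 2 / 3 ≤ r ∧ M.RejectsWithProb x r)}

/-! The two classes differ in cardinality: NQP is countable and BQP is not.

NQP is countable although there are uncountably many machines. At each time the amplitude of a
configuration is an integer polynomial in the transition amplitudes. Whether an input is accepted
with positive probability depends only on which of these polynomials vanish, hence only on the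
finite shape of the machine and on the kernel of the evaluation `MvPolynomial _ ℤ →+* ℂ`
(`acceptedSet_eq_formalAcceptedSet`). There are countably many shapes, and a countable Noetherian
ring has countably many ideals (`countable_range_acceptedSet`).

BQP is uncountable because one amplitude can hide infinitely many digits. On inputs of length `m`, a
fixed machine computes row `m` of Pascal's triangle modulo two and rotates a qubit by `θ` for each
odd entry. By Lucas' theorem the number of odd entries is a power of two, and every `2 ^ j` occurs.
If `θ / π` has binary digits `b`, then rotation by `2 ^ j * θ` shifts digit `j` to the front, and an
offset of `π / 4` turns this digit into an acceptance probability at least `2 / 3` or at most `1 /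
3`, provided that `b` has no three equal consecutive digits (`sin_sq_two_pow_mul`). Following each
digit of an arbitrary sequence `e` by its negation ensures this, and the language obtained
determines `e` (`digitLanguage_injective`). -/

namespace QTM

/-! ### Unidirectional machines and preservation of the norm -/

/-- The symbol in the scanned cell. -/
abbrev Config.read {M : QTM} (c : M.Config) : M.Symbol := c.tape c.head

/-- Every state is entered from the single direction `dir`, and `V` gives the amplitudes. -/
def IsUnidirectional (M : QTM) (dir : M.State → Turing.Dir)
    (V : M.State × M.Symbol → M.State × M.Symbol → ℂ) : Prop :=
  ∀ p σ q τ d, M.amp p σ q τ d = Set.indicator {dir q} (fun _ => V (p, σ) (q, τ)) d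

variable {M : QTM} {dir : M.State → Turing.Dir} {V : M.State × M.Symbol → M.State × M.Symbol → ℂ}

theorem IsUnidirectional.step_eq (h : M.IsUnidirectional dir V) (c : M.Config) :
    M.step c = ∑ y : M.State × M.Symbol,
      Finsupp.single (c.next y.1 y.2 (dir y.1)) (V (c.state, c.read) y) := by
  classical
  rw [step, Fintype.sum_prod_type]
  refine Finset.sum_congr rfl fun q _ => Finset.sum_congr rfl fun τ _ => ?_
  rw [h, h]
  cases hd : dir q <;> simp [Config.read]

/-- The state entered reveals the direction of the last move, hence which cell was scanned and what
was written there. Only the previous state and symbol remain unknown. -/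
theorem Config.next_inj {c c' : M.Config} {y y' : M.State × M.Symbol}
    (h : c.next y.1 y.2 (dir y.1) = c'.next y'.1 y'.2 (dir y'.1)) :
    y = y' ∧ c.head = c'.head ∧ ∀ i ≠ c.head, c.tape i = c'.tape i := by
  have h1 : y.1 = y'.1 := congrArg Config.state h
  have h2 : c.head = c'.head := by
    have := congrArg Config.head h
    simpa [Config.next, h1] using this
  have h3 : ∀ i, Function.update c.tape c.head y.2 i = Function.update c'.tape c'.head y'.2 i :=
    fun i => congrFun (congrArg Config.tape h) i
  refine ⟨Prod.ext h1 ?_, h2, fun i hi => ?_⟩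
  · have := h3 c.head
    rwa [Function.update_self, h2, Function.update_self] at this
  · have := h3 i
    rwa [Function.update_of_ne hi, Function.update_of_ne (h2 ▸ hi)] at this

theorem Config.next_congr {c c' : M.Config} (h : c.head = c'.head)
    (ht : ∀ i ≠ c.head, c.tape i = c'.tape i) (q : M.State) (τ : M.Symbol) (d : Turing.Dir) :
    c.next q τ d = c'.next q τ d := by
  ext1
  · rfl
  · simp [Config.next, h]
  · funext i
    by_cases hi : i = c.head
    · simp [Config.next, ← h, hi]
    · have hi' : i ≠ c'.head := h ▸ hi
      simp [Config.next, Function.update_of_ne hi, Function.update_of_ne hi', ht i hi]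

open Classical in
theorem IsUnidirectional.step_apply_next (h : M.IsUnidirectional dir V) (c c' : M.Config)
    (y : M.State × M.Symbol) :
    M.step c (c'.next y.1 y.2 (dir y.1)) =
      if c.head = c'.head ∧ ∀ i ≠ c.head, c.tape i = c'.tape i then V (c.state, c.read) y
      else 0 := by
  rw [h.step_eq, Finsupp.finsetSum_apply]
  split_ifs with hc
  · rw [Finset.sum_eq_single y]
    · rw [Config.next_congr hc.1 hc.2, Finsupp.single_eq_same]
    · intro y' _ hy
      exact Finsupp.single_eq_of_ne fun he => hy (Config.next_inj he.symm).1
    · simp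
  · refine Finset.sum_eq_zero fun y' _ => Finsupp.single_eq_of_ne fun he => hc ?_
    exact (Config.next_inj he.symm).2

/-- The `L₂` inner product, linear in the second argument. -/
noncomputable def pairing (φ : M.Config →₀ ℂ) : (M.Config →₀ ℂ) →ₗ[ℂ] ℂ :=
  Finsupp.linearCombination ℂ fun c => star (φ c)

theorem pairing_self (ψ : M.Config →₀ ℂ) : pairing ψ ψ = (sqNorm ψ : ℂ) := by
  rw [pairing, Finsupp.linearCombination_apply, sqNorm, Finsupp.sum, Finsupp.sum,
    Complex.ofReal_sum]
  refine Finset.sum_congr rfl fun c _ => ?_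
  simp [Complex.mul_conj']

-- Two configurations have a common successor only if they agree apart from the state and the
-- scanned symbol. The inner product of their images is then that of two rows of `V`, so orthonormal
-- rows make the evolution an isometry.
open Classical in
theorem IsUnidirectional.pairing_evolution (h : M.IsUnidirectional dir V)
    (hV : ∀ x x', ∑ y, V x' y * star (V x y) = if x = x' then 1 else 0) (φ ψ : M.Config →₀ ℂ) :
    pairing (M.evolution φ) (M.evolution ψ) = pairing φ ψ := by
  suffices hs : pairing (M.evolution φ) ∘ₗ M.evolution = pairing φ from
    LinearMap.congr_fun hs ψ
  refine Finsupp.lhom_ext' fun c' => LinearMap.ext_ring ?_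
  have hst : M.evolution (Finsupp.single c' 1) = M.step c' := by simp [evolution]
  have hst' : pairing φ (Finsupp.single c' 1) = star (φ c') := by simp [pairing]
  simp only [LinearMap.comp_apply, Finsupp.lsingle_apply, hst, hst', h.step_eq c', map_sum]
  have : ∀ φ' : M.Config →₀ ℂ, ∀ y : M.State × M.Symbol,
      pairing φ' (Finsupp.single (c'.next y.1 y.2 (dir y.1)) (V (c'.state, c'.read) y)) =
        V (c'.state, c'.read) y * star (φ' (c'.next y.1 y.2 (dir y.1))) := by
    intro φ' y; simp [pairing]
  simp only [this]
  -- The pairing is conjugate-linear in `φ`, so the reduction to basis vectors goes by induction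
  -- instead of extensionality of linear maps.
  induction φ using Finsupp.induction_linear with
  | zero => simp
  | add f g hf hg => simp only [map_add, Finsupp.add_apply, star_add, mul_add,
      Finset.sum_add_distrib, hf (by simp [pairing]), hg (by simp [pairing])]
  | single c a =>
    have hs : M.evolution (Finsupp.single c a) = a • M.step c := by simp [evolution]
    simp only [hs, Finsupp.smul_apply, smul_eq_mul, h.step_apply_next]
    by_cases hc : c.head = c'.head ∧ ∀ i ≠ c.head, c.tape i = c'.tape i
    · simp only [if_pos hc, star_mul']
      have hr : ∀ y, V (c'.state, c'.read) y * (star a * star (V (c.state, c.read) y)) =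
          star a * (V (c'.state, c'.read) y * star (V (c.state, c.read) y)) := fun y => by ring
      simp only [hr]
      rw [← Finset.mul_sum, hV]
      by_cases hx : c = c'
      · simp [hx]
      · rw [if_neg, Finsupp.single_eq_of_ne (Ne.symm hx)]
        · simp
        · intro he
          refine hx (Config.ext (congrArg Prod.fst he) hc.1 (funext fun i => ?_))
          by_cases hi : i = c.head
          · have := congrArg Prod.snd he
            simp only [Config.read] at this
            rw [hi, this, hc.1]
          · exact hc.2 i hi
    · have hx : c' ≠ c := by rintro rfl; simp at hc
      simp [hc, Finsupp.single_eq_of_ne hx]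

open Classical in
theorem IsUnidirectional.wellFormed (h : M.IsUnidirectional dir V)
    (hV : ∀ x x', ∑ y, V x' y * star (V x y) = if x = x' then 1 else 0) : M.WellFormed := by
  intro ψ
  have := h.pairing_evolution hV ψ ψ
  rw [pairing_self, pairing_self] at this
  exact_mod_cast this

/-! ### Uniqueness of the halting time, and acceptance with positive probability -/

theorem superposition_succ (M : QTM) (x : List Bool) (t : ℕ) :
    M.superposition x (t + 1) = M.evolution (M.superposition x t) :=
  Function.iterate_succ_apply' _ _ _

theorem sqNorm_superposition {M : QTM} (h : M.WellFormed) (x : List Bool) (t : ℕ) :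
    sqNorm (M.superposition x t) = 1 := by
  induction t with
  | zero => simp [superposition, sqNorm]
  | succ t ih => rw [superposition_succ, h, ih]

/-- A superposition of norm one is nonzero, so a final configuration is present at time `T`. Applied
in both directions, this makes the halting time, and with it the acceptance probability, unique. -/
theorem HaltsIn.le {M : QTM} (h : M.WellFormed) {x : List Bool} {T T' : ℕ}
    (hT : M.HaltsIn x T) (hT' : M.HaltsIn x T') : T' ≤ T := by
  by_contra! hlt
  have hne : (M.superposition x T).support.Nonempty := by
    rw [Finsupp.support_nonempty_iff]
    intro h0
    have := sqNorm_superposition h x T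
    simp [h0, sqNorm] at this
  obtain ⟨c, hc⟩ := hne
  exact hT'.2 T hlt c hc (hT.1 c hc)

/-- The set of inputs on which `M` halts and accepts with positive probability. -/
def acceptedSet (M : QTM) : Set (List Bool) :=
  {x | ∃ T, M.HaltsIn x T ∧ ∃ c ∈ (M.superposition x T).support, c.IsAccepting}

theorem acceptingWeight_pos_iff {M : QTM} (ψ : M.Config →₀ ℂ) :
    0 < acceptingWeight ψ ↔ ∃ c ∈ ψ.support, c.IsAccepting := by
  classical
  rw [acceptingWeight, Finset.sum_pos_iff_of_nonneg fun _ _ => by positivity]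
  constructor
  · rintro ⟨c, hc, -⟩
    exact ⟨c, (Finset.mem_filter.1 hc).1, (Finset.mem_filter.1 hc).2⟩
  · rintro ⟨c, hc, ha⟩
    exact ⟨c, Finset.mem_filter.2 ⟨hc, ha⟩, by
      have := Finsupp.mem_support_iff.1 hc
      positivity⟩

theorem NQP_subset_range_acceptedSet (K : Set ℂ) : NQP K ⊆ Set.range acceptedSet := by
  rintro S ⟨M, -, hM, -, hS⟩
  refine ⟨M, Set.ext fun x => ⟨?_, fun hx => ?_⟩⟩
  · rintro ⟨T, hT, hacc⟩
    by_contra hx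
    obtain ⟨T', hT', h0⟩ := (hS x).2 hx
    obtain rfl : T = T' := le_antisymm (hT'.le hM.1 hT) (hT.le hM.1 hT')
    have := (acceptingWeight_pos_iff _).2 hacc
    rw [h0] at this
    simp at this
  · obtain ⟨r, hr, T, hT, hw⟩ := (hS x).1 hx
    exact ⟨T, hT, (acceptingWeight_pos_iff _).1 (hw ▸ hr)⟩

/-! ### Evolution with indeterminate amplitudes -/

/-- The arguments of the transition function. -/
abbrev Transition (M : QTM) : Type := M.State × M.Symbol × M.State × M.Symbol × Turing.Dir

/-- The step of `M` with its amplitudes replaced by indeterminates. -/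
noncomputable def formalStep (M : QTM) (c : M.Config) :
    M.Config →₀ MvPolynomial M.Transition ℤ :=
  ∑ q : M.State, ∑ τ : M.Symbol,
    (Finsupp.single (c.next q τ Turing.Dir.left)
        (MvPolynomial.X (c.state, c.tape c.head, q, τ, Turing.Dir.left)) +
      Finsupp.single (c.next q τ Turing.Dir.right)
        (MvPolynomial.X (c.state, c.tape c.head, q, τ, Turing.Dir.right)))

/-- The superposition at time `t` with indeterminate amplitudes. -/
noncomputable def formalSuperposition (M : QTM) (x : List Bool) (t : ℕ) :
    M.Config →₀ MvPolynomial M.Transition ℤ :=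
  (Finsupp.linearCombination _ M.formalStep)^[t] (Finsupp.single (M.initial x) 1)

/-- The set accepted with positive probability when exactly the polynomials in `I` vanish. -/
def formalAcceptedSet (M : QTM) (I : Ideal (MvPolynomial M.Transition ℤ)) : Set (List Bool) :=
  {x | ∃ T, ((∀ c, M.formalSuperposition x T c ∉ I → c.state = M.final) ∧
    ∀ t < T, ∀ c, M.formalSuperposition x t c ∉ I → c.state ≠ M.final) ∧
    ∃ c, M.formalSuperposition x T c ∉ I ∧ c.IsAccepting}

/-! ### Renaming letters and states, and substituting amplitudes for indeterminates -/

section Relabel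

variable (M : QTM) {A S : Type} [Fintype A] [Fintype S] (eA : M.Alphabet ≃ A) (eS : M.State ≃ S)

/-- Rename the letters and the states of a machine, and forget its amplitudes. -/
@[reducible]
def relabel : QTM where
  tracks := M.tracks
  Alphabet := A
  blank := eA M.blank
  bit := fun b => eA (M.bit b)
  bit_injective := eA.injective.comp M.bit_injective
  bit_ne_blank b := eA.injective.ne (M.bit_ne_blank b)
  State := S
  start := eS M.start
  final := eS M.final
  start_ne_final := eS.injective.ne M.start_ne_final
  amp := fun _ _ _ _ _ => 0

/-- The renaming of tape symbols. -/
def relabelSymbol : (M.relabel eA eS).Symbol ≃ M.Symbol :=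
  ((Equiv.refl _).arrowCongr eA.symm).prodCongr (Equiv.refl _)

theorem relabelSymbol_blank :
    M.relabelSymbol eA eS (M.relabel eA eS).blankSymbol = M.blankSymbol := by
  refine Prod.ext (funext fun i => ?_) rfl
  simp [relabelSymbol, blankSymbol]

/-- The renaming of configurations. -/
def relabelConfig (c : (M.relabel eA eS).Config) : M.Config where
  state := eS.symm c.state
  head := c.head
  tape i := M.relabelSymbol eA eS (c.tape i)
  finite_nonblank := by
    convert c.finite_nonblank using 3 with i
    rw [← M.relabelSymbol_blank eA eS]
    exact not_congr (M.relabelSymbol eA eS).injective.eq_iff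

theorem relabelConfig_injective : Function.Injective (M.relabelConfig eA eS) := by
  intro c c' h
  ext1
  · exact eS.symm.injective (congrArg Config.state h)
  · have := congrArg Config.head h
    exact this
  · funext i
    exact (M.relabelSymbol eA eS).injective (congrFun (congrArg Config.tape h) i)

theorem relabelConfig_surjective : Function.Surjective (M.relabelConfig eA eS) := by
  intro c
  refine ⟨⟨eS c.state, c.head, fun i => (M.relabelSymbol eA eS).symm (c.tape i), ?_⟩, ?_⟩
  · convert c.finite_nonblank using 3 with i
    rw [← M.relabelSymbol_blank eA eS]
    exact not_congr (Equiv.symm_apply_eq _)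
  · ext1 <;> simp [relabelConfig]

theorem relabelConfig_initial (x : List Bool) :
    M.relabelConfig eA eS ((M.relabel eA eS).initial x) = M.initial x := by
  ext1
  · simp [relabelConfig, initial]
  · rfl
  · funext i
    change M.relabelSymbol eA eS ((M.relabel eA eS).inputTape x i) = M.inputTape x i
    by_cases h : 0 ≤ i ∧ i.toNat < x.length
    · rw [inputTape, inputTape, dif_pos h, dif_pos h]
      refine Prod.ext (funext fun j => ?_) rfl
      by_cases hj : j = 0 <;> simp [relabelSymbol, hj]
    · rw [inputTape, inputTape, dif_neg h, dif_neg h, relabelSymbol_blank]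

theorem relabelConfig_next (c : (M.relabel eA eS).Config) (q : (M.relabel eA eS).State)
    (τ : (M.relabel eA eS).Symbol) (d : Turing.Dir) :
    M.relabelConfig eA eS (c.next q τ d) =
      (M.relabelConfig eA eS c).next (eS.symm q) (M.relabelSymbol eA eS τ) d := by
  ext1
  · rfl
  · rfl
  · funext i
    by_cases hi : i = c.head
    · simp [relabelConfig, Config.next, hi]
    · simp [relabelConfig, Config.next, Function.update_of_ne hi]

theorem relabelConfig_isAccepting (c : (M.relabel eA eS).Config) :
    (M.relabelConfig eA eS c).IsAccepting ↔ c.IsAccepting := by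
  simp [Config.IsAccepting, relabelConfig, relabelSymbol, Equiv.symm_apply_eq]

/-- Substitution of the amplitudes of `M` for the indeterminates. -/
noncomputable def evalAmp : MvPolynomial (M.relabel eA eS).Transition ℤ →+* ℂ :=
  MvPolynomial.eval₂Hom (Int.castRingHom ℂ) fun i =>
    M.amp (eS.symm i.1) (M.relabelSymbol eA eS i.2.1) (eS.symm i.2.2.1)
      (M.relabelSymbol eA eS i.2.2.2.1) i.2.2.2.2

/-- Substitution of the amplitudes of `M` in a formal superposition. -/
noncomputable def evalSuperposition :
    ((M.relabel eA eS).Config →₀ MvPolynomial (M.relabel eA eS).Transition ℤ) →+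
      (M.Config →₀ ℂ) :=
  (Finsupp.mapDomain.addMonoidHom (M.relabelConfig eA eS)).comp
    (Finsupp.mapRange.addMonoidHom (M.evalAmp eA eS).toAddMonoidHom)

theorem evalSuperposition_single (c : (M.relabel eA eS).Config)
    (P : MvPolynomial (M.relabel eA eS).Transition ℤ) :
    M.evalSuperposition eA eS (Finsupp.single c P) =
      Finsupp.single (M.relabelConfig eA eS c) (M.evalAmp eA eS P) := by
  simp [evalSuperposition]

theorem evalSuperposition_apply
    (ψ : (M.relabel eA eS).Config →₀ MvPolynomial (M.relabel eA eS).Transition ℤ)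
    (c : (M.relabel eA eS).Config) :
    M.evalSuperposition eA eS ψ (M.relabelConfig eA eS c) = M.evalAmp eA eS (ψ c) := by
  simp [evalSuperposition, Finsupp.mapDomain_apply (M.relabelConfig_injective eA eS)]

theorem evalSuperposition_smul (P : MvPolynomial (M.relabel eA eS).Transition ℤ)
    (ψ : (M.relabel eA eS).Config →₀ MvPolynomial (M.relabel eA eS).Transition ℤ) :
    M.evalSuperposition eA eS (P • ψ) = M.evalAmp eA eS P • M.evalSuperposition eA eS ψ := by
  ext c
  obtain ⟨c, rfl⟩ := M.relabelConfig_surjective eA eS c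
  simp [evalSuperposition_apply]

theorem evalSuperposition_formalStep (c : (M.relabel eA eS).Config) :
    M.evalSuperposition eA eS ((M.relabel eA eS).formalStep c) =
      M.step (M.relabelConfig eA eS c) := by
  rw [formalStep, step, map_sum]
  refine Fintype.sum_equiv eS.symm _ _ fun q => ?_
  rw [map_sum]
  refine Fintype.sum_equiv (M.relabelSymbol eA eS) _ _ fun τ => ?_
  rw [map_add, evalSuperposition_single, evalSuperposition_single, relabelConfig_next,
    relabelConfig_next]
  simp [evalAmp, relabelConfig]

/-- Evaluation is a ring homomorphism, so it commutes with a linear evolution once it does so on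
basis vectors. -/
theorem evalSuperposition_evolution
    (ψ : (M.relabel eA eS).Config →₀ MvPolynomial (M.relabel eA eS).Transition ℤ) :
    M.evalSuperposition eA eS (Finsupp.linearCombination _ (M.relabel eA eS).formalStep ψ) =
      M.evolution (M.evalSuperposition eA eS ψ) := by
  induction ψ using Finsupp.induction_linear with
  | zero => simp
  | add f g hf hg => rw [map_add, map_add, map_add, map_add, hf, hg]
  | single c P =>
    rw [Finsupp.linearCombination_single, evalSuperposition_smul, evalSuperposition_formalStep,
      evalSuperposition_single, evolution, Finsupp.linearCombination_single]

theorem evalSuperposition_formalSuperposition (x : List Bool) (t : ℕ) :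
    M.evalSuperposition eA eS ((M.relabel eA eS).formalSuperposition x t) =
      M.superposition x t := by
  induction t with
  | zero => simp [formalSuperposition, superposition, evalSuperposition_single,
      relabelConfig_initial]
  | succ t ih =>
    rw [superposition_succ, ← ih, ← evalSuperposition_evolution, formalSuperposition,
      Function.iterate_succ_apply']
    rfl

/-- Halting and positive acceptance refer only to the supports of superpositions, and a
configuration is in the support exactly when its formal amplitude is outside the kernel of the
evaluation. -/
theorem acceptedSet_eq_formalAcceptedSet :
    M.acceptedSet =
      (M.relabel eA eS).formalAcceptedSet (RingHom.ker (M.evalAmp eA eS)) := by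
  have hmem : ∀ x t c, M.relabelConfig eA eS c ∈ (M.superposition x t).support ↔
      (M.relabel eA eS).formalSuperposition x t c ∉ RingHom.ker (M.evalAmp eA eS) := by
    intro x t c
    rw [Finsupp.mem_support_iff, ← M.evalSuperposition_formalSuperposition eA eS,
      evalSuperposition_apply, RingHom.mem_ker]
  have hfin : ∀ c : (M.relabel eA eS).Config,
      (M.relabelConfig eA eS c).state = M.final ↔ c.state = (M.relabel eA eS).final := by
    intro c
    exact eS.symm_apply_eq
  ext x
  simp only [acceptedSet, formalAcceptedSet, HaltsIn, Set.mem_ofPred_eq,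
    (M.relabelConfig_surjective eA eS).forall, (M.relabelConfig_surjective eA eS).exists, hmem,
    hfin, relabelConfig_isAccepting, ne_eq]

end Relabel

/-! ### Countably many shapes and ideals -/

/-- The finite data of a machine without its amplitudes. -/
abbrev ShapeData : Type :=
  (_ : ℕ) × (a : ℕ) × (n : ℕ) × (Fin a × (Bool → Fin a) × Fin n × Fin n)

/-- The conditions on the letters and states of a machine. -/
def ShapeData.IsValid (s : ShapeData) : Prop :=
  Function.Injective s.2.2.2.2.1 ∧ (∀ b, s.2.2.2.2.1 b ≠ s.2.2.2.1) ∧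
    s.2.2.2.2.2.1 ≠ s.2.2.2.2.2.2

/-- The machine with given data and zero amplitudes. -/
@[reducible]
def ofShape (s : {s : ShapeData // s.IsValid}) : QTM where
  tracks := s.1.1
  Alphabet := Fin s.1.2.1
  blank := s.1.2.2.2.1
  bit := s.1.2.2.2.2.1
  bit_injective := s.2.1
  bit_ne_blank := s.2.2.1
  State := Fin s.1.2.2.1
  start := s.1.2.2.2.2.2.1
  final := s.1.2.2.2.2.2.2
  start_ne_final := s.2.2.2
  amp := fun _ _ _ _ _ => 0

instance : Finite Turing.Dir :=
  Finite.of_injective (fun d => match d with | .left => false | .right => true) fun d d' h => by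
    cases d <;> cases d' <;> simp_all

instance (σ : Type) [Finite σ] : Countable (MvPolynomial σ ℤ) := by
  rw [← Cardinal.mk_le_aleph0_iff]
  refine MvPolynomial.cardinalMk_le_max.trans ?_
  simp

/-- Each ideal is spanned by a finite subset, and a countable ring has only countably many of these.
-/
theorem countable_ideal (R : Type) [CommRing R] [IsNoetherianRing R] [Countable R] :
    Countable (Ideal R) := by
  have : Function.Surjective fun s : Finset R => Ideal.span (s : Set R) :=
    fun I => (isNoetherianRing_iff_ideal_fg R).1 inferInstance I
  exact this.countable

theorem countable_range_acceptedSet : (Set.range acceptedSet).Countable := by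
  have hsub : Set.range acceptedSet ⊆
      ⋃ s : {s : ShapeData // s.IsValid}, Set.range (ofShape s).formalAcceptedSet := by
    rintro _ ⟨M, rfl⟩
    -- Letters and states become elements of `Fin a` and `Fin n`, so that the shape lies in a
    -- countable type.
    have eA := Fintype.equivFin M.Alphabet
    have eS := Fintype.equivFin M.State
    rw [M.acceptedSet_eq_formalAcceptedSet eA eS, Set.mem_iUnion]
    exact ⟨⟨⟨M.tracks, Fintype.card M.Alphabet, Fintype.card M.State, eA M.blank,
      fun b => eA (M.bit b), eS M.start, eS M.final⟩, (M.relabel eA eS).bit_injective,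
      (M.relabel eA eS).bit_ne_blank, (M.relabel eA eS).start_ne_final⟩, _, rfl⟩
  refine Set.Countable.mono hsub (Set.countable_iUnion fun s => ?_)
  have := countable_ideal (MvPolynomial (ofShape s).Transition ℤ)
  exact Set.countable_range _

end QTM

theorem NQP_countable (K : Set ℂ) : (NQP K).Countable :=
  QTM.countable_range_acceptedSet.mono (QTM.NQP_subset_range_acceptedSet K)

/-! ### Odd binomial coefficients -/

/-- The entries of Pascal's triangle modulo two, with an additional zero row on top: row `k + 1`
holds the parities of `Nat.choose k j`. -/
def parityRow : ℕ → ℕ → Bool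
  | 0, _ => false
  | k + 1, 0 => xor (parityRow k 0) (decide (k = 0))
  | k + 1, j + 1 => xor (parityRow k (j + 1)) (parityRow k j)

theorem parityRow_succ_eq (k j : ℕ) : parityRow (k + 1) j = decide (Odd (k.choose j)) := by
  induction k generalizing j with
  | zero =>
    cases j <;> simp [parityRow]
  | succ k ih =>
    cases j with
    | zero => rw [parityRow, ih]; simp
    | succ j =>
      rw [parityRow, ih, ih, Nat.choose_succ_succ]
      by_cases h1 : Odd (k.choose j) <;> by_cases h2 : Odd (k.choose (j + 1)) <;>
        simp [h1, h2, Nat.odd_add, ← Nat.not_odd_iff_even]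

/-- The number of odd entries in row `m` of Pascal's triangle. -/
def oddCount (m : ℕ) : ℕ := ((Finset.range (m + 1)).filter fun i => Odd (m.choose i)).card

/-- Lucas' theorem for the prime two, with the last binary digit split off. -/
theorem odd_choose_iff (n k : ℕ) :
    Odd (n.choose k) ↔ Odd ((n % 2).choose (k % 2)) ∧ Odd ((n / 2).choose (k / 2)) := by
  have : Fact (Nat.Prime 2) := ⟨Nat.prime_two⟩
  have h := Choose.choose_modEq_choose_mod_mul_choose_div_nat (n := n) (k := k) (p := 2)
  rw [← Nat.odd_mul, Nat.odd_iff, Nat.odd_iff, h]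

theorem sum_range_two_mul {α : Type*} [AddCommMonoid α] (f : ℕ → α) (n : ℕ) :
    ∑ i ∈ Finset.range (2 * n), f i = ∑ i ∈ Finset.range n, (f (2 * i) + f (2 * i + 1)) := by
  induction n with
  | zero => simp
  | succ n ih => rw [Nat.mul_succ, Finset.sum_range_succ, Finset.sum_range_succ, ih,
      Finset.sum_range_succ, add_assoc]

theorem oddCount_eq_sum (m : ℕ) :
    oddCount m = ∑ i ∈ Finset.range (m + 1), if Odd (m.choose i) then 1 else 0 := by
  rw [oddCount, Finset.card_filter]

theorem oddCount_two_mul (m : ℕ) : oddCount (2 * m) = oddCount m := by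
  rw [oddCount_eq_sum, oddCount_eq_sum]
  -- The range is padded to even length; the extra coefficient `(2 * m).choose (2 * m + 1)` is zero.
  have h : ∑ i ∈ Finset.range (2 * m + 1), (if Odd ((2 * m).choose i) then 1 else 0) =
      ∑ i ∈ Finset.range (2 * (m + 1)), (if Odd ((2 * m).choose i) then 1 else 0) := by
    rw [Nat.mul_succ, Finset.sum_range_succ _ (2 * m + 1)]
    simp
  rw [h, sum_range_two_mul]
  refine Finset.sum_congr rfl fun i _ => ?_
  have h1 : ¬ Odd ((2 * m).choose (2 * i + 1)) := by
    rw [odd_choose_iff]; simp [Nat.add_mod]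
  have h2 : Odd ((2 * m).choose (2 * i)) ↔ Odd (m.choose i) := by
    rw [odd_choose_iff]; simp
  simp [h1, h2]

theorem oddCount_two_mul_add_one (m : ℕ) : oddCount (2 * m + 1) = 2 * oddCount m := by
  rw [oddCount_eq_sum, oddCount_eq_sum, Finset.mul_sum,
    show 2 * m + 1 + 1 = 2 * (m + 1) by ring, sum_range_two_mul]
  refine Finset.sum_congr rfl fun i _ => ?_
  have hd : ∀ n, (2 * n + 1) / 2 = n := fun n => by omega
  have hr : ∀ n, (2 * n + 1) % 2 = 1 := fun n => by omega
  have h1 : Odd ((2 * m + 1).choose (2 * i + 1)) ↔ Odd (m.choose i) := by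
    rw [odd_choose_iff, hd, hd, hr, hr]; simp
  have h2 : Odd ((2 * m + 1).choose (2 * i)) ↔ Odd (m.choose i) := by
    rw [odd_choose_iff, hd, hr]; simp
  by_cases h : Odd (m.choose i) <;> simp [h1, h2, h]

/-- Removing a last binary digit `0` keeps the count and removing a `1` halves it, so `j` is the
number of ones in the binary expansion of `m`. -/
theorem exists_oddCount_eq_two_pow (m : ℕ) : ∃ j, oddCount m = 2 ^ j := by
  induction m using Nat.strong_induction_on with
  | _ m ih =>
    obtain ⟨n, rfl | rfl⟩ := Nat.even_or_odd' m
    · rcases Nat.eq_zero_or_pos n with rfl | hn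
      · exact ⟨0, by decide⟩
      · rw [oddCount_two_mul]
        exact ih n (by omega)
    · obtain ⟨j, hj⟩ := ih n (by omega)
      exact ⟨j + 1, by rw [oddCount_two_mul_add_one, hj, pow_succ']⟩

/-- The witness built here is `2 ^ j - 1`, whose binary digits are `j` ones. -/
theorem exists_oddCount_eq (j : ℕ) : ∃ m, oddCount m = 2 ^ j := by
  induction j with
  | zero => exact ⟨0, by decide⟩
  | succ j ih =>
    obtain ⟨m, hm⟩ := ih
    exact ⟨2 * m + 1, by rw [oddCount_two_mul_add_one, hm, pow_succ']⟩

/-! ### Reading a binary digit from an angle -/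

/-- The real number in `[0, 1]` with the binary digits `b 0, b 1, …`. -/
noncomputable def binaryReal (b : ℕ → Bool) : ℝ := ∑' i, (b i).toNat * (1 / 2 : ℝ) ^ (i + 1)

theorem summable_binaryReal (b : ℕ → Bool) :
    Summable fun i => ((b i).toNat : ℝ) * (1 / 2 : ℝ) ^ (i + 1) := by
  refine Summable.of_nonneg_of_le (fun i => by positivity) (fun i => ?_)
    ((summable_geometric_of_lt_one (by norm_num) (by norm_num : (1 / 2 : ℝ) < 1)).mul_left (1 / 2))
  rw [pow_succ']
  have : ((b i).toNat : ℝ) ≤ 1 := by exact_mod_cast Bool.toNat_le (b i)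
  exact mul_le_of_le_one_left (by positivity) this

theorem binaryReal_eq (b : ℕ → Bool) :
    binaryReal b = ((b 0).toNat + binaryReal fun i => b (i + 1)) / 2 := by
  rw [binaryReal, (summable_binaryReal b).tsum_eq_zero_add, binaryReal, add_div, ← tsum_div_const]
  congr 1
  · ring
  · exact tsum_congr fun i => by ring

theorem binaryReal_nonneg (b : ℕ → Bool) : 0 ≤ binaryReal b :=
  tsum_nonneg fun i => by positivity

theorem binaryReal_le_one (b : ℕ → Bool) : binaryReal b ≤ 1 := by
  have h := (summable_binaryReal b).tsum_le_tsum (fun i => ?_)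
    ((summable_geometric_of_lt_one (by norm_num) (by norm_num : (1 / 2 : ℝ) < 1)).mul_left (1 / 2))
  · refine h.trans ?_
    rw [tsum_mul_left, tsum_geometric_of_lt_one (by norm_num) (by norm_num)]
    norm_num
  · rw [pow_succ']
    have : ((b i).toNat : ℝ) ≤ 1 := by exact_mod_cast Bool.toNat_le (b i)
    exact mul_le_of_le_one_left (by positivity) this

theorem two_pow_mul_binaryReal (b : ℕ → Bool) (j : ℕ) :
    ∃ n : ℤ, 2 ^ j * binaryReal b = n + binaryReal fun i => b (i + j) := by
  induction j with
  | zero => exact ⟨0, by simp⟩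
  | succ j ih =>
    obtain ⟨n, hn⟩ := ih
    refine ⟨2 * n + (b j).toNat, ?_⟩
    rw [pow_succ', mul_assoc, hn, binaryReal_eq fun i => b (i + j)]
    simp only [zero_add, add_right_comm _ 1 j]
    push_cast
    simp only [add_assoc]
    ring

/-- If there are no three equal digits among the first four, then the first digit is determined
robustly. -/
theorem binaryReal_mem (b : ℕ → Bool) (h : ¬ (b 0 = b 1 ∧ b 1 = b 2))
    (h' : ¬ (b 1 = b 2 ∧ b 2 = b 3)) :
    if b 0 then 9 / 16 ≤ binaryReal b ∧ binaryReal b ≤ 15 / 16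
    else 1 / 16 ≤ binaryReal b ∧ binaryReal b ≤ 7 / 16 := by
  have h0 := binaryReal_nonneg fun i => b (i + 1 + 1 + 1 + 1)
  have h1 := binaryReal_le_one fun i => b (i + 1 + 1 + 1 + 1)
  rw [binaryReal_eq b, binaryReal_eq fun i => b (i + 1), binaryReal_eq fun i => b (i + 1 + 1),
    binaryReal_eq fun i => b (i + 1 + 1 + 1)]
  cases h2 : b 0 <;> cases h3 : b 1 <;> cases h4 : b 2 <;> cases h5 : b 3 <;> simp_all <;>
    constructor <;> linarith

/-- The angle stays within `3π/8` of `π/2`, so its sine is at least `sin (π/8)`, about `0.38`. -/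
theorem one_third_le_sin {y : ℝ} (h1 : 1 / 16 ≤ y) (h2 : y ≤ 7 / 16) :
    1 / 3 ≤ Real.sin (2 * Real.pi * y) := by
  have hpi := Real.pi_pos
  have h8 : 1 / 3 ≤ Real.sin (Real.pi / 8) := by
    rw [Real.sin_pi_div_eight, div_le_div_iff₀ (by norm_num) (by norm_num)]
    have h : √2 ≤ 1.415 := Real.sqrt_le_iff.2 (by norm_num)
    have : 2 / 3 ≤ √(2 - √2) := Real.le_sqrt_of_sq_le (by norm_num at h ⊢; linarith)
    linarith
  refine h8.trans ?_
  -- As cosines of the distances from `π/2`, both values fall under the monotonicity of cosine on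
  -- `[0, π]`.
  rw [← Real.cos_sub_pi_div_two, ← Real.cos_sub_pi_div_two,
    ← Real.cos_abs (2 * Real.pi * y - Real.pi / 2), ← Real.cos_abs (Real.pi / 8 - Real.pi / 2)]
  refine Real.cos_le_cos_of_nonneg_of_le_pi (abs_nonneg _) ?_ ?_
  · rw [abs_le]; constructor <;> linarith
  · rw [abs_of_neg (by linarith : Real.pi / 8 - Real.pi / 2 < 0), abs_le]
    constructor <;> nlinarith

/-- The offset `π/4` gives `sin² = (1 + sin (2πβ)) / 2` for `β = binaryReal b`. The first digit
decides the half of the circle in which `2πβ` lies, and the digit conditions keep it away from the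
ends, so `sin (2πβ)` is at least `1/3` or at most `-1/3`. -/
theorem sin_sq_binaryReal (b : ℕ → Bool) (h : ¬ (b 0 = b 1 ∧ b 1 = b 2))
    (h' : ¬ (b 1 = b 2 ∧ b 2 = b 3)) :
    if b 0 then Real.sin (Real.pi / 4 + Real.pi * binaryReal b) ^ 2 ≤ 1 / 3
    else 2 / 3 ≤ Real.sin (Real.pi / 4 + Real.pi * binaryReal b) ^ 2 := by
  have hb := binaryReal_mem b h h'
  have hs : Real.sin (Real.pi / 4 + Real.pi * binaryReal b) ^ 2 =
      (1 + Real.sin (2 * Real.pi * binaryReal b)) / 2 := by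
    rw [Real.sin_sq_eq_half_sub,
      show 2 * (Real.pi / 4 + Real.pi * binaryReal b) =
        2 * Real.pi * binaryReal b + Real.pi / 2 by ring, Real.cos_add_pi_div_two]
    ring
  rw [hs]
  cases h0 : b 0
  · simp only [h0, Bool.false_eq_true, if_false] at hb ⊢
    have := one_third_le_sin hb.1 hb.2
    linarith
  · simp only [h0, if_true] at hb ⊢
    have := one_third_le_sin (y := binaryReal b - 1 / 2) (by linarith) (by linarith)
    rw [show 2 * Real.pi * (binaryReal b - 1 / 2) = 2 * Real.pi * binaryReal b - Real.pi by ring,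
      Real.sin_sub_pi] at this
    linarith

/-- The digit sequence in which every `e i` is followed by its negation. -/
def pairedDigits (e : ℕ → Bool) (n : ℕ) : Bool := xor (e (n / 2)) (decide (n % 2 = 1))

/-- Any three consecutive positions contain a pair `2n, 2n + 1`, where the digits differ. -/
theorem pairedDigits_not_const (e : ℕ → Bool) (j : ℕ) :
    ¬ (pairedDigits e j = pairedDigits e (j + 1) ∧
      pairedDigits e (j + 1) = pairedDigits e (j + 2)) := by
  obtain ⟨n, rfl | rfl⟩ := Nat.even_or_odd' j
  · rintro ⟨h, -⟩
    simp [pairedDigits, show (2 * n + 1) / 2 = n by omega, show (2 * n + 1) % 2 = 1 by omega] at h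
  · rintro ⟨-, h⟩
    simp [pairedDigits, show (2 * n + 1 + 1) / 2 = n + 1 by omega,
      show (2 * n + 1 + 2) / 2 = n + 1 by omega,
      show (2 * n + 1 + 1) % 2 = 0 by omega, show (2 * n + 1 + 2) % 2 = 1 by omega] at h

theorem pairedDigits_two_mul (e : ℕ → Bool) (n : ℕ) : pairedDigits e (2 * n) = e n := by
  simp [pairedDigits]

/-- The angle after `2 ^ j` rotations reveals the digit `j`. -/
theorem sin_sq_two_pow_mul (e : ℕ → Bool) (j : ℕ) :
    if pairedDigits e j
    then Real.sin (Real.pi / 4 + 2 ^ j * (Real.pi * binaryReal (pairedDigits e))) ^ 2 ≤ 1 / 3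
    else 2 / 3 ≤ Real.sin (Real.pi / 4 + 2 ^ j * (Real.pi * binaryReal (pairedDigits e))) ^ 2 := by
  obtain ⟨n, hn⟩ := two_pow_mul_binaryReal (pairedDigits e) j
  have h := sin_sq_binaryReal (fun i => pairedDigits e (i + j))
    (by simpa only [add_comm _ j, add_zero] using pairedDigits_not_const e j)
    (by simpa only [add_comm _ j] using pairedDigits_not_const e (j + 1))
  have hs : Real.sin (Real.pi / 4 + 2 ^ j * (Real.pi * binaryReal (pairedDigits e))) ^ 2 =
      Real.sin (Real.pi / 4 + Real.pi * binaryReal fun i => pairedDigits e (i + j)) ^ 2 := by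
    -- The integer `n` adds a multiple of `π`, which affects only the sign of the sine and
    -- disappears in the square.
    rw [show Real.pi / 4 + 2 ^ j * (Real.pi * binaryReal (pairedDigits e)) =
      (Real.pi / 4 + Real.pi * binaryReal fun i => pairedDigits e (i + j)) + n * Real.pi by
        linear_combination Real.pi * hn, Real.sin_add_int_mul_pi, mul_pow]
    rw [← zpow_natCast, ← zpow_mul, mul_comm n, zpow_mul]
    simp
  rw [hs]
  simpa only [zero_add] using h

/-! ### Building blocks of unitary transition matrices -/

/-- A left inverse makes `f` injective where it is defined, and a partial injection of a finite set
into itself extends to a permutation. A transition table thus needs entries only for situations that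
matter. -/
theorem exists_perm_of_partial {α : Type*} [Finite α] (f g : α → Option α)
    (h : ∀ x y, f x = some y → g y = some x) :
    ∃ π : Equiv.Perm α, ∀ x y, f x = some y → π x = y := by
  classical
  have := Fintype.ofFinite α
  obtain ⟨e, he⟩ := Set.MapsTo.exists_equiv_extend_of_card_eq (α := α) (β := α)
    (t := Finset.univ) Finset.card_univ.symm (s := {x | (f x).isSome})
    (f := fun x => (f x).getD x) (fun _ _ => by simp) (by
      intro x hx y hy hxy
      obtain ⟨x', hx'⟩ := Option.isSome_iff_exists.1 hx
      obtain ⟨y', hy'⟩ := Option.isSome_iff_exists.1 hy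
      simp only [hx', hy', Option.getD_some] at hxy
      have h1 := h x x' hx'
      rw [hxy, h y y' hy'] at h1
      exact (Option.some.inj h1).symm)
  refine ⟨e.trans (Equiv.subtypeUnivEquiv fun x => Finset.mem_univ x), fun x y hxy => ?_⟩
  have := he x (by simp [hxy])
  simpa [hxy] using this

/-- The vector obtained by a rotation in the plane spanned by `x` and `f x`. -/
noncomputable def rotVec {α : Type*} [DecidableEq α] (f : α → α) (ang : α → ℝ) (x y : α) : ℂ :=
  (Real.cos (ang x) : ℂ) * (if y = x then 1 else 0) +
    (Real.sin (ang x) : ℂ) * (if y = f x then 1 else 0)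

/-- Opposite angles at `x` and `f x` give a rotation matrix on each two-element orbit of the
involution; at a fixed point the angle is its own negative, hence zero. -/
theorem sum_rotVec_mul_star {α : Type*} [DecidableEq α] [Fintype α] {f : α → α} {ang : α → ℝ}
    (hf : ∀ x, f (f x) = x) (hang : ∀ x, ang (f x) = -ang x) (x x' : α) :
    ∑ y, rotVec f ang x' y * star (rotVec f ang x y) = if x = x' then 1 else 0 := by
  have hexp : ∀ y, rotVec f ang x' y * star (rotVec f ang x y) =
      (if y = x' then (Real.cos (ang x') : ℂ) * star (rotVec f ang x y) else 0) +
      (if y = f x' then (Real.sin (ang x') : ℂ) * star (rotVec f ang x y) else 0) := by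
    intro y
    rw [rotVec, add_mul]
    congr 1 <;> split_ifs <;> simp
  simp only [hexp, Finset.sum_add_distrib, Finset.sum_ite_eq', Finset.mem_univ, if_true]
  have hstar : ∀ y, star (rotVec f ang x y) = rotVec f ang x y := by
    intro y
    rw [rotVec]
    split_ifs <;> simp [← Complex.cos_conj, ← Complex.sin_conj]
  rw [hstar, hstar, rotVec, rotVec]
  have hinj : ∀ u v, f u = f v ↔ u = v :=
    fun u v => ⟨fun h => by rw [← hf u, h, hf], congrArg f⟩
  have hswap : f x' = x ↔ x' = f x := ⟨fun h => by rw [← h, hf], fun h => by rw [h, hf]⟩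
  simp only [hinj, hswap]
  by_cases h1 : x' = x
  · subst h1
    by_cases h2 : x' = f x'
    · have h0 : ang x' = 0 := by
        have := hang x'
        rw [← h2] at this
        linarith
      simp [h0]
    · rw [if_neg h2]
      simp only [if_true]
      have := Real.cos_sq_add_sin_sq (ang x')
      have hC : (Real.cos (ang x') : ℂ) ^ 2 + (Real.sin (ang x') : ℂ) ^ 2 = 1 := by
        exact_mod_cast this
      linear_combination hC
  · rw [if_neg h1, if_neg (Ne.symm h1)]
    by_cases h2 : x' = f x
    · subst h2
      simp [hang]
      ring
    · simp [h2]

/-! ### Runs of a machine on a qubit -/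

namespace QTM

/-- The evolution leads from `ψ` to `ψ'` in `n` steps, without final configurations before. -/
def Leads (M : QTM) (n : ℕ) (ψ ψ' : M.Config →₀ ℂ) : Prop :=
  M.evolution^[n] ψ = ψ' ∧ ∀ t < n, ∀ c ∈ (M.evolution^[t] ψ).support, c.state ≠ M.final

namespace Leads

variable {M : QTM} {ψ ψ' ψ'' : M.Config →₀ ℂ} {m n : ℕ}

theorem zero (ψ : M.Config →₀ ℂ) : M.Leads 0 ψ ψ := ⟨rfl, fun _ h => absurd h (Nat.not_lt_zero _)⟩

theorem one (h : M.evolution ψ = ψ') (hf : ∀ c ∈ ψ.support, c.state ≠ M.final) :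
    M.Leads 1 ψ ψ' :=
  ⟨h, fun t ht => by obtain rfl : t = 0 := by omega
                     exact hf⟩

theorem trans (h : M.Leads m ψ ψ') (h' : M.Leads n ψ' ψ'') : M.Leads (m + n) ψ ψ'' := by
  refine ⟨by rw [add_comm, Function.iterate_add_apply, h.1, h'.1], fun t ht => ?_⟩
  rcases lt_or_ge t m with hlt | hge
  · exact h.2 t hlt
  · obtain ⟨s, rfl⟩ := Nat.exists_eq_add_of_le' hge
    rw [Function.iterate_add_apply, h.1]
    exact h'.2 s (by omega)

theorem haltsIn {x : List Bool} (h : M.Leads n (Finsupp.single (M.initial x) 1) ψ)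
    (hψ : ∀ c ∈ ψ.support, c.state = M.final) : M.HaltsIn x n :=
  ⟨by rw [superposition, h.1]; exact hψ, h.2⟩

end Leads

/-- The superposition of `c false` and `c true` in the direction `φ`. -/
noncomputable def qubit {M : QTM} (φ : ℝ) (c : Bool → M.Config) : M.Config →₀ ℂ :=
  Finsupp.single (c false) (Real.cos φ : ℂ) + Finsupp.single (c true) (Real.sin φ : ℂ)

theorem exists_eq_of_mem_support_qubit {M : QTM} {φ : ℝ} {c : Bool → M.Config} {d : M.Config}
    (h : d ∈ (qubit φ c).support) : ∃ z, d = c z := by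
  classical
  rcases Finset.mem_union.1 (Finsupp.support_add h) with h | h
  · exact ⟨false, Finset.mem_singleton.1 (Finsupp.support_single_subset h)⟩
  · exact ⟨true, Finset.mem_singleton.1 (Finsupp.support_single_subset h)⟩

theorem acceptingWeight_qubit {M : QTM} (φ : ℝ) {c : Bool → M.Config} (hc : c false ≠ c true)
    (h0 : ¬ (c false).IsAccepting) (h1 : (c true).IsAccepting) :
    acceptingWeight (qubit φ c) = Real.sin φ ^ 2 := by
  classical
  -- The inclusion may be strict, since the cosine or the sine may vanish; the sum is extended by
  -- zero terms.
  have hsub : (qubit φ c).support ⊆ {c false, c true} := by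
    intro d hd
    obtain ⟨z, rfl⟩ := exists_eq_of_mem_support_qubit hd
    cases z <;> simp
  rw [acceptingWeight, Finset.sum_filter, Finset.sum_subset hsub, Finset.sum_pair hc, if_neg h0,
    if_pos h1, zero_add]
  · rw [qubit, Finsupp.add_apply, Finsupp.single_eq_of_ne hc.symm, Finsupp.single_eq_same, zero_add,
      Complex.norm_real, Real.norm_eq_abs, sq_abs]
  · intro d _ hd
    simp [Finsupp.notMem_support_iff.1 hd]

/-! ### The machine for Pascal's triangle modulo two -/

/-- The states of the machine: it computes the rows of Pascal's triangle modulo two in sweeps to the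
right (with the previous old entry in the state), runs back in between, and finally rotates a qubit
in the state `phase` once for each odd entry of the last row. -/
inductive PascalState
  | start
  | init
  | right (s : Bool)
  | back
  | phase (z : Bool)
  | turn (z : Bool)
  | wait
  | final
  deriving DecidableEq, Fintype

namespace PascalState

/-- The content of a cell: the input letter, the entry of the triangle, and the output. -/
abbrev Cell : Type := Option Bool × Bool × Option Bool

/-- The direction in which a state is entered. -/
def dir : PascalState → Turing.Dir
  | start => .right
  | init => .left
  | right _ => .right
  | back => .left
  | phase _ => .left
  | turn _ => .right
  | wait => .right
  | final => .left

/-- The classical part of the transition function, where it is needed. -/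
def trans : PascalState × Cell → Option (PascalState × Cell)
  | (start, c) => some (init, c)
  -- The carry `true` creates the apex of the triangle; later sweeps start from `back` with carry
  -- `false`.
  | (init, (none, false, none)) => some (right true, (none, false, none))
  | (right s, (some b, a, none)) => some (right a, (some b, xor a s, none))
  | (right false, (none, false, none)) => some (back, (none, false, none))
  -- A one carried past the input is the last entry of row `|x|`: the row is complete and the sweeps
  -- stop.
  | (right true, (none, false, none)) => some (phase false, (none, true, none))
  | (back, (some b, a, none)) => some (back, (some b, a, none))
  | (back, (none, false, none)) => some (right false, (none, false, none))
  | (phase z, (some b, a, none)) => some (phase z, (some b, a, none))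
  | (phase z, (none, false, none)) => some (turn z, (none, false, none))
  -- The bit passes from the state to the output track, so no information is lost. The head goes on
  -- to cell `1`, and `final`, entered leftwards, returns it to the start cell.
  | (turn z, (i, a, none)) => some (wait, (i, a, some z))
  | (wait, c) => some (final, c)
  | (final, c) => some (start, c)
  | _ => none

/-- The inverse of `trans`. -/
def transInv : PascalState × Cell → Option (PascalState × Cell)
  | (start, c) => some (final, c)
  | (init, c) => some (start, c)
  | (right true, (none, c)) => some (init, (none, c))
  | (right false, (none, c)) => some (back, (none, c))
  | (right a, (some b, a', o)) => some (right (xor a a'), (some b, a, o))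
  | (back, (some b, c)) => some (back, (some b, c))
  | (back, (none, c)) => some (right false, (none, c))
  | (phase z, (none, true, o)) => if z then none else some (right true, (none, false, o))
  | (phase z, c) => some (phase z, c)
  | (turn z, c) => some (phase z, c)
  | (wait, (i, a, some z)) => some (turn z, (i, a, none))
  | (wait, (_, _, none)) => none
  | (final, c) => some (wait, c)

/-- The table is reversible because a sweep keeps the overwritten entry in the state, from which the
previous carry is recovered by `xor`. -/
theorem transInv_eq (x y : PascalState × Cell) (h : trans x = some y) : transInv y = some x := by
  obtain ⟨q, i, a, o⟩ := x
  rcases q with _ | _ | (_ | _) | _ | (_ | _) | (_ | _) | _ | _ <;> rcases i with _ | (_ | _) <;>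
    rcases a with _ | _ <;> rcases o with _ | (_ | _) <;> simp [trans] at h <;> subst h <;> rfl

/-- A permutation that extends `trans`. -/
noncomputable def perm : Equiv.Perm (PascalState × Cell) :=
  (exists_perm_of_partial trans transInv transInv_eq).choose

theorem perm_eq {x y : PascalState × Cell} (h : trans x = some y) : perm x = y :=
  (exists_perm_of_partial trans transInv transInv_eq).choose_spec x y h

/-- Exchange of the two basis states of the qubit. -/
def flip : PascalState → PascalState
  | phase z => phase !z
  | q => q

/-- The angle of the rotation at a cell. -/
noncomputable def cellAngle (θ θ₀ : ℝ) (c : Cell) : ℝ :=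
  if c.2.1 then if c.1.isSome then θ else θ₀ else 0

/-- The angle of the rotation, with a sign for the two basis states of the qubit. -/
noncomputable def angle (θ θ₀ : ℝ) (c : Cell) : PascalState → ℝ
  | phase false => cellAngle θ θ₀ c
  | phase true => -cellAngle θ θ₀ c
  | _ => 0

end PascalState

open PascalState

/-- Cell contents as symbols of a machine with one track besides the output track. -/
def cellEquiv : ((Fin (0 + 1) → Option Bool × Bool) × Option Bool) ≃ Cell where
  toFun σ := ((σ.1 0).1, (σ.1 0).2, σ.2)
  invFun c := (fun _ => (c.1, c.2.1), c.2.2)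
  left_inv σ := Prod.ext (funext fun i => by rw [Subsingleton.elim (α := Fin 1) i 0]) rfl
  right_inv _ := rfl

/-- The effect of `PascalState.perm` on pairs of a state and a symbol. -/
noncomputable def pascalPerm :
    Equiv.Perm (PascalState × ((Fin (0 + 1) → Option Bool × Bool) × Option Bool)) :=
  (((Equiv.refl _).prodCongr cellEquiv).trans perm).trans
    ((Equiv.refl _).prodCongr cellEquiv.symm)

/-- The local transition matrix: the classical part, followed by a rotation of the qubit. -/
noncomputable def pascalMatrix (θ θ₀ : ℝ)
    (x y : PascalState × ((Fin (0 + 1) → Option Bool × Bool) × Option Bool)) : ℂ :=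
  rotVec (fun x => (x.1.flip, x.2)) (fun x => angle θ θ₀ (cellEquiv x.2) x.1) (pascalPerm x) y

/-- The machine that rotates a qubit by `θ₀`, and by `θ` for each odd binomial coefficient
`(m choose i)` with `i < m`, where `m` is the length of the input. -/
@[reducible]
noncomputable def pascalMachine (θ θ₀ : ℝ) : QTM where
  tracks := 0
  Alphabet := Option Bool × Bool
  blank := (none, false)
  bit b := (some b, false)
  bit_injective b b' h := by simpa using h
  bit_ne_blank b := by simp
  State := PascalState
  start := PascalState.start
  final := PascalState.final
  start_ne_final := by simp
  amp p σ q τ := Set.indicator {q.dir} fun _ => pascalMatrix θ θ₀ (p, σ) (q, τ)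

variable {θ θ₀ : ℝ}

theorem pascalMachine_isUnidirectional :
    (pascalMachine θ θ₀).IsUnidirectional PascalState.dir (pascalMatrix θ θ₀) :=
  fun _ _ _ _ _ => rfl

/-- The permutation only reorders the rows of a rotation matrix, as `flip` is an involution that
reverses the sign of `angle`. -/
theorem pascalMachine_wellFormed : (pascalMachine θ θ₀).WellFormed := by
  refine pascalMachine_isUnidirectional.wellFormed fun x x' => ?_
  simp only [pascalMatrix]
  refine (sum_rotVec_mul_star ?_ ?_ _ _).trans ?_
  · rintro ⟨q, σ⟩
    cases q <;> simp [PascalState.flip]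
  · rintro ⟨q, σ⟩
    rcases q with _ | _ | _ | _ | (_ | _) | _ | _ | _ <;> simp [PascalState.flip, angle]
  · simp only [pascalPerm.injective.eq_iff]
    congr

theorem pascalPerm_eq {p q : PascalState} {σ : (pascalMachine θ θ₀).Symbol} {c : Cell}
    (h : PascalState.trans (p, cellEquiv σ) = some (q, c)) :
    pascalPerm (p, σ) = (q, cellEquiv.symm c) := by
  simp [pascalPerm, perm_eq h]

theorem pascalMachine_step {c : (pascalMachine θ θ₀).Config} {q : PascalState}
    {d : Cell}
    (h : PascalState.trans (c.state, cellEquiv c.read) = some (q, d)) :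
    (pascalMachine θ θ₀).step c =
      Finsupp.single (c.next q (cellEquiv.symm d) q.dir) (Real.cos (angle θ θ₀ d q) : ℂ) +
        Finsupp.single (c.next q.flip (cellEquiv.symm d) q.flip.dir)
          (Real.sin (angle θ θ₀ d q) : ℂ) := by
  have hV : ∀ y, pascalMatrix θ θ₀ (c.state, c.read) y =
      (if y = (q, cellEquiv.symm d) then (Real.cos (angle θ θ₀ d q) : ℂ) else 0) +
        (if y = (q.flip, cellEquiv.symm d) then (Real.sin (angle θ θ₀ d q) : ℂ) else 0) := by
    intro y
    rw [pascalMatrix, pascalPerm_eq (θ := θ) (θ₀ := θ₀) h, rotVec]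
    simp
  rw [pascalMachine_isUnidirectional.step_eq]
  simp only [hV, Finsupp.single_add, Finset.sum_add_distrib]
  congr 1
  · rw [Finset.sum_eq_single (q, cellEquiv.symm d)] <;> simp +contextual
  · rw [Finset.sum_eq_single (q.flip, cellEquiv.symm d)] <;> simp +contextual

theorem pascalMachine_normalForm : (pascalMachine θ θ₀).NormalForm := by
  intro σ q τ d
  have h : PascalState.trans (.final, cellEquiv σ) = some (.start, cellEquiv σ) := rfl
  change Set.indicator {PascalState.dir q}
    (fun _ => pascalMatrix θ θ₀ (PascalState.final, σ) (q, τ)) d = _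
  rw [pascalMatrix, pascalPerm_eq (θ := θ) (θ₀ := θ₀) h, rotVec]
  simp only [angle, PascalState.flip, Equiv.symm_apply_apply, Real.cos_zero, Real.sin_zero,
    Prod.mk.injEq, Set.indicator_apply, Set.mem_singleton_iff]
  by_cases h1 : q = PascalState.start
  · subst h1
    by_cases h2 : τ = σ <;> simp [h2, PascalState.dir]
  · simp [h1]

theorem pascalMachine_evolution_single {c : (pascalMachine θ θ₀).Config} {q : PascalState}
    {d : Cell} (h : PascalState.trans (c.state, cellEquiv c.read) = some (q, d))
    (hq : angle θ θ₀ d q = 0) (r : ℂ) :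
    (pascalMachine θ θ₀).evolution (Finsupp.single c r) =
      Finsupp.single (c.next q (cellEquiv.symm d) q.dir) r := by
  rw [evolution, Finsupp.linearCombination_single, pascalMachine_step h, hq]
  simp

theorem leads_single {c : (pascalMachine θ θ₀).Config} {q : PascalState} {d : Cell}
    (h : PascalState.trans (c.state, cellEquiv c.read) = some (q, d))
    (hq : angle θ θ₀ d q = 0) (hc : c.state ≠ PascalState.final) :
    (pascalMachine θ θ₀).Leads 1 (Finsupp.single c 1)
      (Finsupp.single (c.next q (cellEquiv.symm d) q.dir) 1) := by
  refine Leads.one (pascalMachine_evolution_single h hq 1) fun d hd => ?_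
  rw [Finset.mem_singleton.1 (Finsupp.support_single_subset hd)]
  exact hc

theorem leads_qubit_of_single {c : (pascalMachine θ θ₀).Config} {d : Cell}
    (h : PascalState.trans (c.state, cellEquiv c.read) = some (phase false, d))
    (hc : c.state ≠ PascalState.final) :
    (pascalMachine θ θ₀).Leads 1 (Finsupp.single c 1)
      (qubit (cellAngle θ θ₀ d) fun z => c.next (phase z) (cellEquiv.symm d) .left) := by
  refine Leads.one ?_ fun d hd => ?_
  · rw [evolution, Finsupp.linearCombination_single, pascalMachine_step h, one_smul]
    rfl
  · rw [Finset.mem_singleton.1 (Finsupp.support_single_subset hd)]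
    exact hc

theorem leads_qubit {φ : ℝ} {c : Bool → (pascalMachine θ θ₀).Config} {q : Bool → PascalState}
    {d : Bool → Cell}
    (h : ∀ z, PascalState.trans ((c z).state, cellEquiv (c z).read) = some (q z, d z))
    (hq : ∀ z, angle θ θ₀ (d z) (q z) = 0) (hc : ∀ z, (c z).state ≠ PascalState.final) :
    (pascalMachine θ θ₀).Leads 1 (qubit φ c)
      (qubit φ fun z => (c z).next (q z) (cellEquiv.symm (d z)) (q z).dir) := by
  refine Leads.one ?_ fun d hd => ?_
  · rw [qubit, map_add, pascalMachine_evolution_single (h _) (hq _),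
      pascalMachine_evolution_single (h _) (hq _)]
    rfl
  · obtain ⟨z, rfl⟩ := exists_eq_of_mem_support_qubit hd
    exact hc z

/-- By `hn` both branches reach the same two configurations and interfere there; the addition
formulas for cosine and sine then add the angles. -/
theorem leads_qubit_rotate {φ : ℝ} {c c' : Bool → (pascalMachine θ θ₀).Config} {d : Cell}
    (h : ∀ z, PascalState.trans ((c z).state, cellEquiv (c z).read) = some (phase z, d))
    (hn : ∀ z z', (c z).next (phase z') (cellEquiv.symm d) .left = c' z')
    (hc : ∀ z, (c z).state ≠ PascalState.final) :
    (pascalMachine θ θ₀).Leads 1 (qubit φ c) (qubit (φ + cellAngle θ θ₀ d) c') := by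
  refine Leads.one ?_ fun d hd => ?_
  · have hf : ∀ z, (PascalState.phase z).flip = phase !z := fun z => rfl
    have hd : ∀ z, (PascalState.phase z).dir = .left := fun z => rfl
    rw [qubit, map_add, evolution, Finsupp.linearCombination_single,
      Finsupp.linearCombination_single, pascalMachine_step (h _), pascalMachine_step (h _)]
    simp only [hf, hd, hn, Bool.not_true, Bool.not_false, angle, Real.cos_neg, Real.sin_neg,
      smul_add, Finsupp.smul_single, smul_eq_mul, qubit, Real.cos_add, Real.sin_add]
    rw [add_comm (Finsupp.single (c' true) _) (Finsupp.single (c' false) _), add_add_add_comm,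
      ← Finsupp.single_add, ← Finsupp.single_add]
    push_cast
    congr 2 <;> ring
  · obtain ⟨z, rfl⟩ := exists_eq_of_mem_support_qubit hd
    exact hc z

/-! ### Configurations of the computation -/

/-- The input letter in a cell. -/
def inputLetter (x : List Bool) (i : ℤ) : Option Bool := if 0 ≤ i then x[i.toNat]? else none

/-- The cell contents for the input `x`, the row `r` and the output `o`. -/
def cellAt (x : List Bool) (r : ℕ → Bool) (o : Option Bool) (i : ℤ) : Cell :=
  -- The row has one cell more than the input: column `|x|` carries no input letter.
  (inputLetter x i, decide (0 ≤ i ∧ i ≤ x.length) && r i.toNat, if i = 0 then o else none)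

theorem cellAt_natCast (x : List Bool) (r : ℕ → Bool) (j : ℕ) (h : j ≤ x.length) :
    cellAt x r none j = (x[j]?, r j, none) := by
  simp [cellAt, inputLetter, h]

theorem cellAt_neg_one (x : List Bool) (r : ℕ → Bool) (o : Option Bool) :
    cellAt x r o (-1) = (none, false, none) := by
  simp [cellAt, inputLetter]

theorem cellAt_congr {x : List Bool} {r r' : ℕ → Bool} {o : Option Bool}
    {i : ℤ} (h : ∀ j : ℕ, j ≤ x.length → (j : ℤ) = i → r j = r' j) :
    cellAt x r o i = cellAt x r' o i := by
  by_cases hi : 0 ≤ i ∧ i ≤ x.length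
  · rw [cellAt, cellAt, h i.toNat (by omega) (by omega)]
  · simp [cellAt, hi]

variable (θ θ₀) in
/-- The configuration with given state, head position, row of the triangle and output. -/
def pascalConfig (x : List Bool) (q : PascalState) (h : ℤ) (r : ℕ → Bool) (o : Option Bool) :
    (pascalMachine θ θ₀).Config where
  state := q
  head := h
  tape i := cellEquiv.symm (cellAt x r o i)
  finite_nonblank := by
    refine (Set.finite_Icc (0 : ℤ) x.length).subset fun i hi => ?_
    by_contra hn
    have hn' : ¬ (0 ≤ i ∧ i ≤ x.length) := hn
    have h0 : i ≠ 0 := by rintro rfl; simp at hn'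
    have hl : inputLetter x i = none := by
      rw [inputLetter]
      split_ifs with h
      · exact List.getElem?_eq_none (by omega)
      · rfl
    refine hi ?_
    simp [cellAt, hl, hn', h0]
    rfl

theorem initial_eq (x : List Bool) :
    (pascalMachine θ θ₀).initial x = pascalConfig θ θ₀ x .start 0 (parityRow 0) none := by
  ext1
  · rfl
  · rfl
  · funext i
    change inputTape (pascalMachine θ θ₀) x i = cellEquiv.symm (cellAt x (parityRow 0) none i)
    by_cases h : 0 ≤ i ∧ i.toNat < x.length
    · rw [inputTape, dif_pos h]
      refine Prod.ext (funext fun j => ?_) (by simp [cellEquiv, cellAt])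
      rw [Subsingleton.elim (α := Fin 1) j 0]
      simp [cellEquiv, cellAt, inputLetter, h.1, h.2, parityRow]
    · have hl : inputLetter x i = none := by
        rw [inputLetter]
        split_ifs with h'
        · exact List.getElem?_eq_none (by omega)
        · rfl
      rw [inputTape, dif_neg h]
      simp [cellEquiv, cellAt, hl, parityRow, blankSymbol]

theorem cellEquiv_read (x : List Bool) (q : PascalState) (h : ℤ) (r : ℕ → Bool)
    (o : Option Bool) : cellEquiv (pascalConfig θ θ₀ x q h r o).read = cellAt x r o h := rfl

theorem pascalConfig_next {x : List Bool} {q q' : PascalState} {h : ℤ} {r r' : ℕ → Bool}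
    {o o' : Option Bool} (ht : ∀ i ≠ h, cellAt x r o i = cellAt x r' o' i) (d : Turing.Dir) :
    (pascalConfig θ θ₀ x q h r o).next q' (cellEquiv.symm (cellAt x r' o' h)) d =
      pascalConfig θ θ₀ x q' (h + d.shift) r' o' := by
  ext1
  · rfl
  · rfl
  · funext i
    by_cases hi : i = h
    · subst hi
      simp [Config.next, pascalConfig]
    · simp [Config.next, pascalConfig, hi, ht i hi]

theorem leads_config {x : List Bool} {q q' : PascalState} {h h' : ℤ} {r r' : ℕ → Bool}
    (ht : PascalState.trans (q, cellAt x r none h) = some (q', cellAt x r' none h))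
    (hr : ∀ j : ℕ, j ≤ x.length → (j : ℤ) ≠ h → r j = r' j) (hh : h + q'.dir.shift = h')
    (hq : ∀ c, angle θ θ₀ c q' = 0) (hf : q ≠ .final) :
    (pascalMachine θ θ₀).Leads 1 (Finsupp.single (pascalConfig θ θ₀ x q h r none) 1)
      (Finsupp.single (pascalConfig θ θ₀ x q' h' r' none) 1) := by
  have := leads_single (θ := θ) (θ₀ := θ₀) (c := pascalConfig θ θ₀ x q h r none) ht (hq _) hf
  rwa [pascalConfig_next (fun i hi => cellAt_congr fun j hj hji => hr j hj (hji ▸ hi)), hh] at this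

/-! ### The sweeps -/

/-- The row `k` of the triangle, overwritten with the row `k + 1` before the position `j`. -/
def mixedRow (k j i : ℕ) : Bool := if i < j then parityRow (k + 1) i else parityRow k i

/-- The bit in the state when the cell `j` is reached in the sweep `k`. -/
def carry (k : ℕ) : ℕ → Bool
  | 0 => decide (k = 0)
  | j + 1 => parityRow k j

theorem parityRow_succ (k j : ℕ) : parityRow (k + 1) j = xor (parityRow k j) (carry k j) := by
  cases j <;> rfl

theorem parityRow_eq_false {k j : ℕ} (h : k ≤ j) : parityRow k j = false := by
  cases k with
  | zero => rfl
  | succ k => rw [parityRow_succ_eq, Nat.choose_eq_zero_of_lt h]; simp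

theorem mixedRow_self (k j : ℕ) : mixedRow k j j = parityRow k j := by simp [mixedRow]

theorem mixedRow_succ_self (k j : ℕ) : mixedRow k (j + 1) j = parityRow (k + 1) j := by
  simp [mixedRow]

theorem mixedRow_succ_of_ne {k j i : ℕ} (h : i ≠ j) : mixedRow k j i = mixedRow k (j + 1) i := by
  simp only [mixedRow, show i < j ↔ i < j + 1 by omega]

/-- Pascal's rule applied in place: the new entry `j` needs the old entry `j - 1`, already
overwritten, so the state carries it along. -/
theorem leads_right (x : List Bool) (k : ℕ) {j : ℕ} (hj : j ≤ x.length) :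
    (pascalMachine θ θ₀).Leads j
      (Finsupp.single (pascalConfig θ θ₀ x (right (carry k 0)) 0 (parityRow k) none) 1)
      (Finsupp.single (pascalConfig θ θ₀ x (right (carry k j)) j (mixedRow k j) none) 1) := by
  induction j with
  | zero => exact Leads.zero _
  | succ j ih =>
    refine (ih (by omega)).trans (leads_config ?_ ?_ ?_ ?_ ?_)
    · rw [cellAt_natCast _ _ _ (by omega), cellAt_natCast _ _ _ (by omega),
        List.getElem?_eq_getElem (by omega), mixedRow_self, mixedRow_succ_self, parityRow_succ]
      rfl
    · intro i _ hi
      exact mixedRow_succ_of_ne (by exact_mod_cast hi)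
    · simp [PascalState.dir, Turing.Dir.shift]
    · exact fun _ => rfl
    · simp

theorem leads_back (x : List Bool) (r : ℕ → Bool) {j : ℕ} (hj : j ≤ x.length) :
    (pascalMachine θ θ₀).Leads j
      (Finsupp.single (pascalConfig θ θ₀ x back (j - 1) r none) 1)
      (Finsupp.single (pascalConfig θ θ₀ x back (-1) r none) 1) := by
  induction j with
  | zero => exact Leads.zero _
  | succ j ih =>
    rw [add_comm j 1]
    have hj' : ((1 + j : ℕ) : ℤ) - 1 = j := by push_cast; ring
    rw [hj']
    refine (leads_config ?_ (fun _ _ _ => rfl) ?_ ?_ ?_).trans (ih (by omega))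
    · rw [cellAt_natCast _ _ _ (by omega), List.getElem?_eq_getElem (by omega)]
      rfl
    · rfl
    · exact fun _ => rfl
    · simp

/-- The state at the left end before the sweep `k`. -/
def sweepState (k : ℕ) : PascalState := if k = 0 then init else back

theorem leads_turn_left (x : List Bool) (k : ℕ) :
    (pascalMachine θ θ₀).Leads 1
      (Finsupp.single (pascalConfig θ θ₀ x (sweepState k) (-1) (parityRow k) none) 1)
      (Finsupp.single (pascalConfig θ θ₀ x (right (carry k 0)) 0 (parityRow k) none) 1) := by
  refine leads_config ?_ (fun _ _ _ => rfl) ?_ ?_ ?_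
  · rw [cellAt_neg_one]
    cases k <;> rfl
  · rfl
  · exact fun _ => rfl
  · cases k <;> simp [sweepState]

theorem leads_to_end (x : List Bool) (k : ℕ) :
    (pascalMachine θ θ₀).Leads (1 + x.length)
      (Finsupp.single (pascalConfig θ θ₀ x (sweepState k) (-1) (parityRow k) none) 1)
      (Finsupp.single (pascalConfig θ θ₀ x (right (carry k x.length)) x.length
        (mixedRow k x.length) none) 1) :=
  (leads_turn_left x k).trans (leads_right x k le_rfl)

theorem cellAt_length_mixedRow (x : List Bool) {k : ℕ} (h : k ≤ x.length) :
    cellAt x (mixedRow k x.length) none x.length = (none, false, none) := by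
  rw [cellAt_natCast _ _ _ le_rfl, mixedRow_self, parityRow_eq_false h]
  simp

theorem cellAt_length_parityRow (x : List Bool) (k : ℕ) :
    cellAt x (parityRow k) none x.length = (none, parityRow k x.length, none) := by
  rw [cellAt_natCast _ _ _ le_rfl]
  simp

theorem carry_length {m k : ℕ} (h : k ≤ m) : carry k m = parityRow (k + 1) m := by
  rw [parityRow_succ, parityRow_eq_false h, Bool.false_xor]

theorem mixedRow_eq_parityRow_succ (k : ℕ) {m j : ℕ} (hj : j ≤ m) (h : j ≠ m) :
    mixedRow k m j = parityRow (k + 1) j := by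
  simp [mixedRow, lt_of_le_of_ne hj h]

/-- For `k < |x|` the new row has no odd entry in column `|x|`, so the carry at the right end is
`false` and the head runs back. -/
theorem leads_sweep (x : List Bool) {k : ℕ} (h : k < x.length) :
    (pascalMachine θ θ₀).Leads (1 + x.length + (1 + x.length))
      (Finsupp.single (pascalConfig θ θ₀ x (sweepState k) (-1) (parityRow k) none) 1)
      (Finsupp.single (pascalConfig θ θ₀ x (sweepState (k + 1)) (-1) (parityRow (k + 1)) none)
        1) := by
  refine (leads_to_end x k).trans (Leads.trans (leads_config ?_ ?_ ?_ ?_ ?_)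
    (leads_back x _ le_rfl))
  · rw [cellAt_length_mixedRow x h.le, cellAt_length_parityRow, carry_length h.le,
      parityRow_eq_false h]
    rfl
  · intro j hj hne
    exact mixedRow_eq_parityRow_succ k hj (by exact_mod_cast hne)
  · rfl
  · exact fun _ => rfl
  · simp

theorem leads_sweeps (x : List Bool) {k : ℕ} (h : k ≤ x.length) :
    (pascalMachine θ θ₀).Leads (1 + k * (1 + x.length + (1 + x.length)))
      (Finsupp.single ((pascalMachine θ θ₀).initial x) 1)
      (Finsupp.single (pascalConfig θ θ₀ x (sweepState k) (-1) (parityRow k) none) 1) := by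
  induction k with
  | zero =>
    rw [initial_eq, zero_mul]
    exact leads_config rfl (fun _ _ _ => rfl) rfl (fun _ => rfl) (by simp)
  | succ k ih =>
    rw [add_one_mul, ← add_assoc]
    exact (ih (by omega)).trans (leads_sweep x h)

/-- In sweep `|x|` the carry at the right end is `|x| choose |x| = 1`. Writing it creates the qubit,
rotated by the special angle of the cell without input letter. -/
theorem leads_phase_start (x : List Bool) :
    (pascalMachine θ θ₀).Leads 1
      (Finsupp.single (pascalConfig θ θ₀ x (right (carry x.length x.length)) x.length
        (mixedRow x.length x.length) none) 1)
      (qubit θ₀ fun z => pascalConfig θ θ₀ x (phase z) (x.length - 1)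
        (parityRow (x.length + 1)) none) := by
  have hp : parityRow (x.length + 1) x.length = true := by
    rw [parityRow_succ_eq]; simp
  have hc := cellAt_length_parityRow x (x.length + 1)
  have := leads_qubit_of_single (θ := θ) (θ₀ := θ₀)
    (c := pascalConfig θ θ₀ x (right (carry x.length x.length)) x.length
      (mixedRow x.length x.length) none)
    (d := cellAt x (parityRow (x.length + 1)) none x.length) ?_ ?_
  · have hcongr : ∀ i ≠ (x.length : ℤ), cellAt x (mixedRow x.length x.length) none i =
        cellAt x (parityRow (x.length + 1)) none i := fun i hi =>
      cellAt_congr fun j hj hji =>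
        mixedRow_eq_parityRow_succ x.length hj fun h => hi (by rw [← hji, h])
    simp only [pascalConfig_next hcongr] at this
    rw [hc, hp] at this
    exact this
  · rw [cellEquiv_read, cellAt_length_mixedRow x le_rfl, hc, carry_length le_rfl, hp]
    rfl
  · simp [pascalConfig]

theorem leads_phase (x : List Bool) (r : ℕ → Bool) (φ : ℝ) {j : ℕ} (hj : j ≤ x.length) :
    (pascalMachine θ θ₀).Leads j
      (qubit φ fun z => pascalConfig θ θ₀ x (phase z) (j - 1) r none)
      (qubit (φ + ((Finset.range j).filter fun i => r i).card * θ) fun z =>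
        pascalConfig θ θ₀ x (phase z) (-1) r none) := by
  induction j generalizing φ with
  | zero => simpa using Leads.zero _
  | succ j ih =>
    have hcell : cellAt x r none j = (some x[j], r j, none) := by
      rw [cellAt_natCast _ _ _ (by omega), List.getElem?_eq_getElem (by omega)]
    have hstep := leads_qubit_rotate (θ := θ) (θ₀ := θ₀) (φ := φ)
      (c := fun z => pascalConfig θ θ₀ x (phase z) j r none)
      (c' := fun z => pascalConfig θ θ₀ x (phase z) (j - 1) r none)
      (d := cellAt x r none j) ?_ ?_ ?_
    · have := hstep.trans (ih _ (by omega))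
      have hang : φ + cellAngle θ θ₀ (cellAt x r none j) +
          ((Finset.range j).filter fun i => r i).card * θ =
          φ + ((Finset.range (j + 1)).filter fun i => r i).card * θ := by
        rw [hcell, Finset.range_add_one, Finset.filter_insert]
        cases hr : r j <;> simp [cellAngle]
        ring
      rw [hang, add_comm 1 j] at this
      simpa using this
    · intro z
      rw [cellEquiv_read, hcell]
      rfl
    · intro z z'
      rw [pascalConfig_next fun _ _ => rfl]
      rfl
    · intro z
      simp [pascalConfig]

theorem leads_output (x : List Bool) (r : ℕ → Bool) (φ : ℝ) :
    (pascalMachine θ θ₀).Leads (1 + 1 + 1)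
      (qubit φ fun z => pascalConfig θ θ₀ x (phase z) (-1) r none)
      (qubit φ fun z => pascalConfig θ θ₀ x .final 0 r (some z)) := by
  have h1 := leads_qubit (θ := θ) (θ₀ := θ₀) (φ := φ)
    (c := fun z => pascalConfig θ θ₀ x (phase z) (-1) r none)
    (q := turn) (d := fun _ => cellAt x r none (-1)) ?_ (fun _ => rfl) ?_
  · simp only [pascalConfig_next fun _ _ => rfl] at h1
    have h2 := leads_qubit (θ := θ) (θ₀ := θ₀) (φ := φ)
      (c := fun z => pascalConfig θ θ₀ x (turn z) 0 r none)
      (q := fun _ => wait) (d := fun z => cellAt x r (some z) 0) ?_ (fun _ => rfl) ?_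
    · have hne : ∀ z, ∀ i ≠ (0 : ℤ), cellAt x r none i = cellAt x r (some z) i := by
        intro z i hi
        simp [cellAt, hi]
      simp only [pascalConfig_next (hne _)] at h2
      have h3 := leads_qubit (θ := θ) (θ₀ := θ₀) (φ := φ)
        (c := fun z => pascalConfig θ θ₀ x wait 1 r (some z))
        (q := fun _ => .final) (d := fun z => cellAt x r (some z) 1) ?_ (fun _ => rfl) ?_
      · simp only [pascalConfig_next fun _ _ => rfl] at h3
        exact (h1.trans h2).trans h3
      · exact fun _ => rfl
      · simp [pascalConfig]
    · intro z
      simp only [cellEquiv_read]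
      simp [cellAt, pascalConfig, PascalState.trans]
    · simp [pascalConfig]
  · intro z
    rw [cellEquiv_read, cellAt_neg_one]
    rfl
  · simp [pascalConfig]

/-! ### Running time and acceptance probability -/

/-- The running time for inputs of length `m`. -/
def pascalTime (m : ℕ) : ℕ := 1 + m * (1 + m + (1 + m)) + (1 + m) + 1 + m + (1 + 1 + 1)

theorem card_filter_parityRow (m : ℕ) :
    ((Finset.range m).filter fun i => parityRow (m + 1) i).card + 1 = oddCount m := by
  rw [oddCount, Finset.range_add_one, Finset.filter_insert, if_pos (by simp),
    Finset.card_insert_of_notMem (by simp)]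
  simp [parityRow_succ_eq]

/-- The entry in column `|x|` is odd and should contribute `θ` as well. Its cell also supplies the
offset `θ₀`, whence the machine parameter `θ + θ₀`. -/
theorem leads_final (x : List Bool) :
    (pascalMachine θ (θ + θ₀)).Leads (pascalTime x.length)
      (Finsupp.single ((pascalMachine θ (θ + θ₀)).initial x) 1)
      (qubit (θ₀ + oddCount x.length * θ) fun z =>
        pascalConfig θ (θ + θ₀) x .final 0 (parityRow (x.length + 1)) (some z)) := by
  have hang : θ₀ + oddCount x.length * θ = θ + θ₀ +
      ((Finset.range x.length).filter fun i => parityRow (x.length + 1) i).card * θ := by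
    rw [← card_filter_parityRow]
    push_cast
    ring
  rw [hang]
  exact ((((leads_sweeps x le_rfl).trans (leads_to_end x _)).trans (leads_phase_start x)).trans
    (leads_phase x _ _ le_rfl)).trans (leads_output x _ _)

theorem pascalMachine_haltsIn (x : List Bool) :
    (pascalMachine θ (θ + θ₀)).HaltsIn x (pascalTime x.length) := by
  refine (leads_final x).haltsIn fun c hc => ?_
  obtain ⟨z, rfl⟩ := exists_eq_of_mem_support_qubit hc
  rfl

theorem pascalMachine_polynomialTime : (pascalMachine θ (θ + θ₀)).PolynomialTime := by
  -- One initial step, `m` sweeps of `2 (m + 1)` steps, a last run of `m + 1` steps to the right,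
  -- one step creating the qubit, `m` rotation steps and three output steps.
  refine ⟨2 * (Polynomial.X + 1) ^ 2 + 4, fun x => ⟨_, ?_, pascalMachine_haltsIn x⟩⟩
  simp [pascalTime]
  ring

theorem pascalMachine_conservative : (pascalMachine θ (θ + θ₀)).Conservative := by
  refine ⟨pascalMachine_wellFormed, fun x => ⟨_, pascalMachine_haltsIn x, fun c hc => ?_⟩,
    pascalMachine_normalForm⟩
  rw [superposition, (leads_final x).1] at hc
  obtain ⟨z, rfl⟩ := exists_eq_of_mem_support_qubit hc
  rfl

theorem pascalMachine_acceptsWithProb (x : List Bool) :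
    (pascalMachine θ (θ + θ₀)).AcceptsWithProb x
      (Real.sin (θ₀ + oddCount x.length * θ) ^ 2) := by
  refine ⟨_, pascalMachine_haltsIn x, ?_⟩
  rw [superposition, (leads_final x).1]
  have hout : ∀ z, ((pascalConfig θ (θ + θ₀) x .final 0 (parityRow (x.length + 1))
      (some z)).tape 0).2 = some z := fun z => by
    simp [pascalConfig, cellEquiv, cellAt]
  refine acceptingWeight_qubit _ ?_ ?_ ?_
  · intro h
    have := congrArg (fun c => (Config.tape c 0).2) h
    simp only [hout] at this
    simp at this
  · rintro ⟨-, h, -⟩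
    rw [hout] at h
    simp at h
  · refine ⟨rfl, hout true, fun i hi => ?_⟩
    simp [pascalConfig, cellEquiv, cellAt, hi]

end QTM

/-! ### Uncountably many languages in BQP -/

/-- The inputs `x` such that `2 ^ j` binomial coefficients `(|x| choose i)` are odd, for some `j` at
which the paired digit sequence of `e` vanishes. -/
def digitLanguage (e : ℕ → Bool) : Set (List Bool) :=
  {x | pairedDigits e (Nat.log 2 (oddCount x.length)) = false}

theorem digitLanguage_mem_BQP (e : ℕ → Bool) : digitLanguage e ∈ BQP Set.univ := by
  refine ⟨QTM.pascalMachine (Real.pi * binaryReal (pairedDigits e)) (_ + Real.pi / 4),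
    QTM.pascalMachine_polynomialTime, QTM.pascalMachine_conservative,
    fun _ _ _ _ _ => Set.mem_univ _, fun x => ?_⟩
  have hacc := QTM.pascalMachine_acceptsWithProb (θ := Real.pi * binaryReal (pairedDigits e))
    (θ₀ := Real.pi / 4) x
  obtain ⟨j, hj⟩ := exists_oddCount_eq_two_pow x.length
  have hsin := sin_sq_two_pow_mul e j
  have hmem : x ∈ digitLanguage e ↔ pairedDigits e j = false := by
    rw [digitLanguage, Set.mem_ofPred_eq, hj, Nat.log_pow one_lt_two]
  rw [hj] at hacc
  push_cast at hacc
  refine ⟨fun hx => ⟨_, ?_, hacc⟩, fun hx => ⟨_, ?_, by rwa [QTM.RejectsWithProb, sub_sub_cancel]⟩⟩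
  · simpa [hmem.1 hx] using hsin
  · rw [hmem, Bool.not_eq_false] at hx
    simp only [hx, if_true] at hsin
    linarith

/-- An input whose length has `2 ^ (2 * i)` odd binomial coefficients tests the paired digit `2 *
i`, which is `e i`. -/
theorem digitLanguage_injective : Function.Injective digitLanguage := by
  intro e e' h
  funext i
  obtain ⟨m, hm⟩ := exists_oddCount_eq (2 * i)
  have := congrArg (List.replicate m true ∈ ·) h
  simpa [digitLanguage, hm, Nat.log_pow one_lt_two, pairedDigits_two_mul] using this

theorem BQP_not_countable : ¬ (BQP Set.univ).Countable := by
  intro h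
  have : Countable (BQP Set.univ) := h
  have hinj : Function.Injective fun e : ℕ → Bool =>
      (⟨digitLanguage e, digitLanguage_mem_BQP e⟩ : BQP Set.univ) :=
    fun e e' he => digitLanguage_injective (congrArg Subtype.val he)
  have hcard : Cardinal.mk (ℕ → Bool) = 2 ^ Cardinal.aleph0 := by simp
  exact (Cardinal.cantor Cardinal.aleph0).not_ge
    (hcard ▸ Cardinal.mk_le_aleph0_iff.2 hinj.countable)

theorem mainTheorem2 : BQP (Set.univ : Set ℂ) ≠ NQP (Set.univ : Set ℂ) :=
  fun h => BQP_not_countable (h ▸ NQP_countable _)
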